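/- Proposition (free monads inherit costrength). Let $(\mathcal M,\otimes,I)$ be a monoidal category and let $\mathcal A$ be a left $\mathcal M$-actegory, i.e. a category with a functor $\mathcal M\times\mathcal A\to\mathcal A$, $(M,X)\mapsto M\cdot X$, and coherent natural isomorphisms $(M\otimes N)\cdot X\cong M\cdot(N\cdot X)$, $I\cdot X\cong X$. A costrength on a functor $F:\mathcal A\to\mathcal A$ is a family $\mathsf{cst}^F_{M,X}:F(M\cdot X)\to M\cdot FX$, natural in $M$ and $X$ and compatible with these isomorphisms. The identity functor has the identity costrength, and composites of costrong functors have the composite costrength. A natural transformation $\alpha:F\to G$ of costrong functors is costrong if $\mathsf{cst}^G_{M,X}\circ\alpha_{M\cdot X}=(M\cdot\alpha_X)\circ\mathsf{cst}^F_{M,X}$. A costrong monad is a monad $T$ with a costrength on its underlying functor for which the unit $\eta:\mathrm{id}\to T$ and the multiplication $\mu:TT\to T$ are costrong. A monad is (algebraically) free on $F$ if it is the monad generated by a left adjoint to the forgetful functor $\mathbf{Alg}(F)\to\mathcal A$. Suppose that $\mathcal A$ is locally presentable and that $F:\mathcal A\to\mathcal A$ is an accessible functor with an $\mathcal M$-costrength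 $\mathsf{cst}^F$. Then: 1. The free monad on $F$ exists; that is, the forgetful functor $\mathbf{Alg}(F)\to\mathcal A$ has a left adjoint. 2. Let $T$ be a free monad on $F$, with unit $\eta$ and with free algebra structures $\sigma_X:FTX\to TX$. For every $X$, the object $TX$ with the structure $\mathsf{in}_X=[\eta_X,\sigma_X]:X+FTX\to TX$ is an initial algebra of the endofunctor $Y\mapsto X+FY$; that is, $TX=\mu Y.\,X+FY$. 3. For every $M$ in $\mathcal M$ and $X$ in $\mathcal A$ there is a unique morphism $\mathsf{cst}^T_{M,X}:T(M\cdot X)\to M\cdot TX$ such that $$\mathsf{cst}^T_{M,X}\circ\mathsf{in}_{M\cdot X}=(M\cdot\mathsf{in}_X)\circ[M\cdot\mathsf{inl},M\cdot\mathsf{inr}]\circ(\mathrm{id}_{M\cdot X}+\mathsf{cst}^F_{M,TX})\circ(\mathrm{id}_{M\cdot X}+F\mathsf{cst}^T_{M,X}).$$ The morphisms $\mathsf{cst}^T_{M,X}$ form an $\mathcal M$-costrength on $T$, and with it $T$ is an $\mathcal M$-costrong monad. -/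

import Mathlib

open CategoryTheory Limits MonoidalCategory MonoidalLeftAction

universe w v u v₁ u₁

namespace CategoryTheory.Costrong

section Costrength

/-! A left actegory over `M` is a category `A` with `[MonoidalLeftAction M A]`, and an `M`-costrength
on a functor `F` is a structure `F.OplaxLeftLinear M`: a family
`δₗ : F.obj (m ⊙ₗ X) ⟶ m ⊙ₗ F.obj X`, natural in both variables and compatible with the
associativity and unit isomorphisms of the actions. -/

variable {A : Type u} [Category.{v} A] {M : Type u₁} [Category.{v₁} M] [MonoidalCategory M]
  [MonoidalLeftAction M A]

/-- The component `F (m · X) ⟶ m · F X` of a costrength `s` on an endofunctor `F`. -/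
abbrev cst {F : A ⥤ A} (s : F.OplaxLeftLinear M) (m : M) (X : A) :
    F.obj (m ⊙ₗ X) ⟶ m ⊙ₗ F.obj X :=
  s.δₗ m X

/-- The identity costrength on the identity functor. -/
@[reducible]
def idCostrength (A : Type u) [Category.{v} A] (M : Type u₁) [Category.{v₁} M]
    [MonoidalCategory M] [MonoidalLeftAction M A] : (𝟭 A).OplaxLeftLinear M where
  δₗ m X := 𝟙 (m ⊙ₗ X)

/-- The costrength `G (F (m · X)) ⟶ G (m · F X) ⟶ m · G (F X)` on a composite of costrong
functors. -/
@[reducible]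
def compCostrength {F G : A ⥤ A} (s : F.OplaxLeftLinear M) (t : G.OplaxLeftLinear M) :
    (F ⋙ G).OplaxLeftLinear M where
  δₗ m X := G.map (cst s m X) ≫ cst t m (F.obj X)
  δₗ_naturality_left f X := by
    simp only [Functor.comp_map, Functor.comp_obj, ← Functor.map_comp_assoc, Category.assoc,
      s.δₗ_naturality_left]
    simp only [Functor.map_comp, Category.assoc, t.δₗ_naturality_left]
  δₗ_naturality_right m _ _ f := by
    simp only [Functor.comp_map, Functor.comp_obj, ← Functor.map_comp_assoc, Category.assoc,
      s.δₗ_naturality_right]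
    simp only [Functor.map_comp, Category.assoc, t.δₗ_naturality_right]
  δₗ_associativity m n X := by
    have h1 := congrArg G.map (s.δₗ_associativity m n X)
    have h2 := t.δₗ_associativity m n (F.obj X)
    have h3 := t.δₗ_naturality_right m (cst s n X)
    simp only [Functor.map_comp] at h1
    simp only [Functor.comp_map, Functor.comp_obj, Category.assoc, actionHomRight_comp, h2,
      reassoc_of% h1, reassoc_of% h3]
  δₗ_unitality_inv X := by
    simp only [Functor.comp_map, Functor.comp_obj, ← Functor.map_comp_assoc,
      ← s.δₗ_unitality_inv, ← t.δₗ_unitality_inv]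

/-- A natural transformation `α : F ⟶ G` between costrong functors is costrong when it commutes
with the costrengths. -/
def IsCostrongTrans {F G : A ⥤ A} (s : F.OplaxLeftLinear M) (t : G.OplaxLeftLinear M)
    (α : F ⟶ G) : Prop :=
  ∀ (m : M) (X : A), α.app (m ⊙ₗ X) ≫ cst t m X = cst s m X ≫ m ⊴ₗ α.app X

/-- A monad `T` with a costrength `s` on its underlying functor is a costrong monad when its unit
and its multiplication are costrong natural transformations. -/
structure IsCostrongMonad (T : Monad A) (s : T.toFunctor.OplaxLeftLinear M) : Prop where
  unit : IsCostrongTrans (idCostrength A M) s T.η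
  mul : IsCostrongTrans (compCostrength s s) s T.μ

end Costrength

section FreeMonad

variable {A : Type u} [Category.{v} A]

/-- The (algebraically) free monads on `F`: a left adjoint to the forgetful functor from
`F`-algebras to `A`. The monad itself is the one generated by the adjunction. -/
structure FreeMonad (F : A ⥤ A) where
  /-- The free algebra functor. -/
  free : A ⥤ Endofunctor.Algebra F
  /-- The free-forgetful adjunction. -/
  adj : free ⊣ Endofunctor.Algebra.forget F

/-- The monad generated by the free-forgetful adjunction. -/
def FreeMonad.toMonad {F : A ⥤ A} (T : FreeMonad F) : Monad A :=
  T.adj.toMonad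

/-- The `F`-algebra structure `F (T X) ⟶ T X` of the free algebra on `X`. -/
def FreeMonad.str {F : A ⥤ A} (T : FreeMonad F) (X : A) :
    F.obj (T.toMonad.obj X) ⟶ T.toMonad.obj X :=
  (T.free.obj X).str

variable [HasBinaryCoproducts A]

/-- The endofunctor `Y ↦ X + F Y`. -/
noncomputable abbrev coprodFunctor (F : A ⥤ A) (X : A) : A ⥤ A :=
  F ⋙ coprod.functor.obj X

/-- The map `X + F (T X) ⟶ T X` given by the unit of `T` and the free algebra structure. -/
noncomputable def FreeMonad.inMap {F : A ⥤ A} (T : FreeMonad F) (X : A) :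
    X ⨿ F.obj (T.toMonad.obj X) ⟶ T.toMonad.obj X :=
  coprod.desc (T.toMonad.η.app X) (T.str X)

/-- `T X` as an algebra for `Y ↦ X + F Y`. -/
noncomputable def FreeMonad.inAlgebra {F : A ⥤ A} (T : FreeMonad F) (X : A) :
    Endofunctor.Algebra (coprodFunctor F X) where
  a := T.toMonad.obj X
  str := T.inMap X

variable {M : Type u₁} [Category.{v₁} M] [MonoidalCategory M] [MonoidalLeftAction M A]

/-- The square saying that `f : T (m · X) ⟶ m · T X` is a morphism from the initial algebra of
`Y ↦ m · X + F Y`, with source structure map `in` and target structure map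
`m · X + F (m · T X) ⟶ m · X + m · F (T X) ⟶ m · (X + F (T X)) ⟶ m · T X`. -/
def FreeMonad.CostrengthSquare {F : A ⥤ A} (T : FreeMonad F) (s : F.OplaxLeftLinear M) (m : M)
    (X : A) (f : T.toMonad.obj (m ⊙ₗ X) ⟶ m ⊙ₗ T.toMonad.obj X) : Prop :=
  T.inMap (m ⊙ₗ X) ≫ f =
    coprod.map (𝟙 (m ⊙ₗ X)) (F.map f) ≫
      coprod.map (𝟙 (m ⊙ₗ X)) (cst s m (T.toMonad.obj X)) ≫
        coprod.desc (m ⊴ₗ (coprod.inl : X ⟶ X ⨿ F.obj (T.toMonad.obj X)))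
          (m ⊴ₗ (coprod.inr : F.obj (T.toMonad.obj X) ⟶ X ⨿ F.obj (T.toMonad.obj X))) ≫
          m ⊴ₗ T.inMap X

end FreeMonad

/-- A locally presentable category has binary coproducts. -/
theorem hasBinaryCoproducts_of_isLocallyPresentable (A : Type u) [Category.{v} A]
    [IsLocallyPresentable.{w} A] : HasBinaryCoproducts A := by
  obtain ⟨κ, _, _⟩ := IsLocallyPresentable.exists_cardinal.{w} A
  have : HasFiniteColimits A := hasFiniteColimits_of_hasColimitsOfSize A
  infer_instance

end CategoryTheory.Costrong

/-!
The free algebra on `X` is the initial algebra of `H = (Y ↦ X + F Y)`, so the existence of the free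
monad comes down to initial algebras of accessible endofunctors. These are reached through
coalgebras. A coalgebra `c : V ⟶ H V` is *recursive* if for every algebra `b : H B ⟶ B` there is
exactly one `f : V ⟶ B` with `f = c ≫ H f ≫ b`. Recursive coalgebras are stable under colimits and
under `V ↦ H V`, and `c` itself is a morphism of coalgebras `V ⟶ H V`. Iterating this step `κ` times
from the initial coalgebra, where `H` preserves `κ`-filtered colimits, therefore gives a recursive
coalgebra, and its structure map is invertible because `H` preserves the colimit of the chain
(`Coalgebra.isIso_str_of_isColimit`). A recursive coalgebra with invertible structure map, read
backwards, is an initial algebra (`Coalgebra.isInitialOfIsRecursiveMap`).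

For an arbitrary free monad `T`, a morphism of `F`-algebras out of `T X` is determined by its
restriction to `X`, which may be prescribed (`FreeMonad.hom_ext`, `FreeMonad.lift`); this is also
the initiality of `T X` as an algebra of `Y ↦ X + F Y`. The costrength at `m` and `X` is the
morphism of `F`-algebras `T (m · X) ⟶ m · T X` that extends `m · η`, for the structure `F (m · T
X) ⟶ m · F (T X) ⟶ m · T X`. The axioms of a costrength and the compatibility with the
multiplication are equations between morphisms of `F`-algebras that agree on generators. The
action `m · -` need not preserve any colimits.
-/

/-! ### Colimits of coalgebras -/

namespace CategoryTheory.Endofunctor.Coalgebra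

variable {C : Type u} [Category.{v} C] {H : C ⥤ C}

/-- If `i` and `i ≫ d` are morphisms of coalgebras, then the condition for `d` to be one holds after
precomposition with `i`. -/
lemma comp_str_map_eq {U V W : Coalgebra H} {i : U.V ⟶ V.V} {d : V.V ⟶ W.V} {a : U.V ⟶ W.V}
    (hi : i ≫ V.str = U.str ≫ H.map i) (hd : i ≫ d = a) (ha : U.str ≫ H.map a = a ≫ W.str) :
    i ≫ V.str ≫ H.map d = i ≫ d ≫ W.str := by
  rw [reassoc_of% hi, ← H.map_comp, reassoc_of% hd, hd, ha]

section Colimits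

variable {J : Type u₁} [Category.{v₁} J] (K : J ⥤ Coalgebra H)

/-- The structure maps of a diagram of coalgebras, as a natural transformation. -/
def diagramStr : K ⋙ forget H ⟶ (K ⋙ forget H) ⋙ H where
  app j := (K.obj j).str
  naturality _ _ f := (K.map f).h.symm

variable {K} {c : Cocone (K ⋙ forget H)} (hc : IsColimit c)

/-- A colimit cocone of the underlying objects of a diagram of coalgebras, as a cocone of
coalgebras. -/
def liftedCocone : Cocone K where
  pt := ⟨c.pt, hc.desc ((Cocone.precompose (diagramStr K)).obj (H.mapCocone c))⟩
  ι :=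
    { app j :=
        { f := c.ι.app j
          h := (hc.fac ((Cocone.precompose (diagramStr K)).obj (H.mapCocone c)) j).symm }
      naturality _ _ f := Coalgebra.ext (c.ι.naturality f) }

/-- The lifted cocone is a colimit cocone: colimits of coalgebras are computed in the base
category. -/
def isColimitLiftedCocone : IsColimit (liftedCocone hc) where
  desc s :=
    { f := hc.desc ((forget H).mapCocone s)
      h := hc.hom_ext fun j ↦
        comp_str_map_eq (V := (liftedCocone hc).pt)
          (hc.fac ((Cocone.precompose (diagramStr K)).obj (H.mapCocone c)) j)
          (hc.fac ((forget H).mapCocone s) j) (s.ι.app j).h }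
  fac s j := Coalgebra.ext (hc.fac ((forget H).mapCocone s) j)
  uniq s m hm := Coalgebra.ext
    (hc.uniq ((forget H).mapCocone s) m.f fun j ↦ congrArg Hom.f (hm j))

variable (J H)

instance hasColimitsOfShape [HasColimitsOfShape J C] : HasColimitsOfShape J (Coalgebra H) where
  has_colimit K := ⟨⟨liftedCocone (colimit.isColimit (K ⋙ forget H)), isColimitLiftedCocone _⟩⟩

instance preservesColimitsOfShape_forget [HasColimitsOfShape J C] :
    PreservesColimitsOfShape J (forget H) where
  preservesColimit {K} :=
    preservesColimit_of_preserves_colimit_cocone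
      (isColimitLiftedCocone (colimit.isColimit (K ⋙ forget H)))
      (colimit.isColimit (K ⋙ forget H))

end Colimits

/-! ### Recursive coalgebras -/

/-- A map `c : V ⟶ H V` is recursive if for every algebra `b : H B ⟶ B` the recursive
equation `f = c ≫ H f ≫ b` has exactly one solution `f : V ⟶ B`. -/
def IsRecursiveMap {V : C} (c : V ⟶ H.obj V) : Prop :=
  ∀ (B : C) (b : H.obj B ⟶ B), ∃ f : V ⟶ B, c ≫ H.map f ≫ b = f ∧
    ∀ g : V ⟶ B, c ≫ H.map g ≫ b = g → g = f

lemma IsRecursiveMap.map {V : C} {c : V ⟶ H.obj V} (hc : IsRecursiveMap c) :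
    IsRecursiveMap (H.map c) := by
  intro B b
  obtain ⟨f, hf, huniq⟩ := hc B b
  refine ⟨H.map f ≫ b, ?_, fun g hg ↦ ?_⟩
  · rw [← H.map_comp_assoc, hf]
  · -- a solution `g` on `H V` restricts along `c` to the solution on `V`
    have h : c ≫ g = f := huniq _ (by rw [H.map_comp, Category.assoc, hg])
    rw [← h, H.map_comp, Category.assoc, hg]

variable (H) in
/-- The coalgebras with recursive structure map. -/
def isRecursive : ObjectProperty (Coalgebra H) := fun V ↦ IsRecursiveMap V.str

/-- The coalgebra `H V ⟶ H (H V)` obtained by applying `H` to the structure of `V`. -/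
@[reducible]
def succ (V : Coalgebra H) : Coalgebra H := ⟨H.obj V.V, H.map V.str⟩

/-- The structure map of a coalgebra, as a morphism of coalgebras. -/
@[reducible]
def toSucc (V : Coalgebra H) : V ⟶ V.succ := Hom.mk V.str rfl

/-- Solutions of the recursive equations restrict along morphisms of coalgebras. -/
lemma Hom.comp_solution {V W : Coalgebra H} (a : V ⟶ W) {B : C} {b : H.obj B ⟶ B} {g : W.V ⟶ B}
    (hg : W.str ≫ H.map g ≫ b = g) : V.str ≫ H.map (a.f ≫ g) ≫ b = a.f ≫ g := by
  rw [H.map_comp, Category.assoc, a.h_assoc, hg]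

instance isClosedUnderColimitsOfShape_isRecursive (J : Type u₁) [Category.{v₁} J]
    [HasColimitsOfShape J C] : (isRecursive H).IsClosedUnderColimitsOfShape J where
  colimitsOfShape_le := by
    rintro V ⟨p⟩ B b
    have hp := isColimitOfPreserves (forget H) p.isColimit
    choose f hf huniq using fun j ↦ p.prop_diag_obj j B b
    let s : Cocone (p.diag ⋙ forget H) :=
      { pt := B
        ι :=
          { app := f
            naturality i j a :=
              (huniq i _ (Hom.comp_solution (p.diag.map a) (hf j))).trans
                (Category.comp_id _).symm } }
    have hext {g h : V.V ⟶ B} (hgh : ∀ j, (p.ι.app j).f ≫ g = (p.ι.app j).f ≫ h) : g = h :=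
      hp.hom_ext hgh
    obtain ⟨d, hd⟩ : ∃ d : V.V ⟶ B, ∀ j, (p.ι.app j).f ≫ d = f j := ⟨hp.desc s, hp.fac s⟩
    have hι (j) : (p.ι.app j).f ≫ V.str = (p.diag.obj j).str ≫ H.map (p.ι.app j).f :=
      (p.ι.app j).h.symm
    refine ⟨d, hext fun j ↦ ?_, fun g hg ↦ hext fun j ↦ ?_⟩
    · rw [reassoc_of% (hι j), ← H.map_comp_assoc, hd, hf]
    · rw [hd]
      exact huniq j _ (Hom.comp_solution (p.ι.app j) hg)

/-- A recursive coalgebra with invertible structure map is an initial algebra. -/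
noncomputable def isInitialOfIsRecursiveMap {V : C} (c : V ⟶ H.obj V) (hc : IsRecursiveMap c)
    [IsIso c] : IsInitial (⟨V, inv c⟩ : Algebra H) :=
  IsInitial.ofUniqueHom
    (fun B ↦
      { f := (hc B.a B.str).choose
        h := by rw [IsIso.eq_inv_comp, (hc B.a B.str).choose_spec.1] })
    (fun B m ↦ Algebra.ext ((hc B.a B.str).choose_spec.2 _ (by
      rw [m.h, IsIso.hom_inv_id_assoc])))

/-! ### The initial algebra chain -/

/-- If `D` is a chain of coalgebras whose successor steps are the structure maps `D j ⟶ H (D j)`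
and `H` preserves its colimit, then the colimit has an invertible structure map. -/
lemma isIso_str_of_isColimit {J : Type u₁} [LinearOrder J] [SuccOrder J]
    [PreservesColimitsOfShape J H] {D : J ⥤ Coalgebra H} {c : Cocone D}
    (hc : IsColimit ((forget H).mapCocone c)) (e : ∀ j, D.obj (Order.succ j) ≅ (D.obj j).succ)
    (he : ∀ j, D.map (homOfLE (Order.le_succ j)) = (D.obj j).toSucc ≫ (e j).inv) :
    IsIso c.pt.str := by
  have hH := isColimitOfPreserves H hc
  have hext {B : C} {g h : c.pt.V ⟶ B} (hgh : ∀ j, (c.ι.app j).f ≫ g = (c.ι.app j).f ≫ h) :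
      g = h := hc.hom_ext hgh
  have hHext {B : C} {g h : H.obj c.pt.V ⟶ B}
      (hgh : ∀ j, H.map (c.ι.app j).f ≫ g = H.map (c.ι.app j).f ≫ h) : g = h :=
    hH.hom_ext hgh
  have hι (j) : (c.ι.app j).f ≫ c.pt.str = (D.obj j).str ≫ H.map (c.ι.app j).f :=
    (c.ι.app j).h.symm
  have hw {i j} (a : i ⟶ j) : (D.map a).f ≫ (c.ι.app j).f = (c.ι.app i).f :=
    congrArg Hom.f (c.w a)
  have hsucc (j) : (D.map (homOfLE (Order.le_succ j))).f = (D.obj j).str ≫ (e j).inv.f :=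
    congrArg Hom.f (he j)
  have hinv (j) : (e j).inv.f ≫ (D.obj (Order.succ j)).str =
      H.map ((D.obj j).str ≫ (e j).inv.f) := by
    rw [H.map_comp]
    exact (e j).inv.h.symm
  -- the maps `H (D j) ≅ D (succ j) ⟶ colim D` form a cocone
  have hcocone {i j : J} (a : i ⟶ j) :
      H.map (D.map a).f ≫ (e j).inv.f ≫ (c.ι.app (Order.succ j)).f =
        (e i).inv.f ≫ (c.ι.app (Order.succ i)).f := by
    obtain rfl | hij := eq_or_ne i j
    · rw [Subsingleton.elim a (𝟙 i), D.map_id, id_f, H.map_id, Category.id_comp]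
    · -- `D i ⟶ D j` factors through the step `D i ⟶ D (succ i)`
      let b : Order.succ i ⟶ j := homOfLE (Order.succ_le_of_lt (lt_of_le_of_ne (leOfHom a) hij))
      have hb : (D.map b).f ≫ (D.obj j).str = (D.obj (Order.succ i)).str ≫ H.map (D.map b).f :=
        (D.map b).h.symm
      rw [Subsingleton.elim a (homOfLE (Order.le_succ i) ≫ b), D.map_comp, comp_f, hsucc,
        H.map_comp, ← hinv, Category.assoc, Category.assoc, ← reassoc_of% hb,
        ← reassoc_of% (hsucc j), hw, hw]
  let s : Cocone ((D ⋙ forget H) ⋙ H) :=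
    { pt := c.pt.V
      ι :=
        { app j := (e j).inv.f ≫ (c.ι.app (Order.succ j)).f
          naturality i j a := (hcocone a).trans (Category.comp_id _).symm } }
  obtain ⟨d, hd⟩ : ∃ d : H.obj c.pt.V ⟶ c.pt.V,
      ∀ j, H.map (c.ι.app j).f ≫ d = (e j).inv.f ≫ (c.ι.app (Order.succ j)).f :=
    ⟨hH.desc s, hH.fac s⟩
  refine ⟨d, hext fun j ↦ ?_, hHext fun j ↦ ?_⟩
  · rw [reassoc_of% (hι j), hd, ← reassoc_of% (hsucc j), hw]
    exact (Category.comp_id _).symm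
  · rw [reassoc_of% (hd j), hι, reassoc_of% (hinv j), ← H.map_comp, Category.assoc,
      ← reassoc_of% (hsucc j), hw]
    exact (Category.comp_id _).symm

section Chain

open SmallObject

variable [HasColimitsOfSize.{w, w} C]

variable (H) in
/-- The successor structure on recursive coalgebras that starts with the initial one and maps
`V` to `H V`. Its iteration is the initial algebra chain `0 ⟶ H 0 ⟶ H (H 0) ⟶ ⋯`. -/
noncomputable def chainSuccStruct : SuccStruct (isRecursive H).FullSubcategory :=
  haveI : HasFiniteColimits C := hasFiniteColimits_of_hasColimitsOfSize C
  haveI : HasColimitsOfShape (Discrete.{0} PEmpty) C := inferInstanceAs (HasInitial C)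
  { X₀ := ⊥_ _
    succ V := ⟨V.obj.succ, V.property.map⟩
    toSucc V := ⟨V.obj.toSucc⟩ }

/-- The colimit of the initial algebra chain of length `κ`, where `H` is `κ`-accessible. -/
lemma exists_isRecursive_isIso_str (κ : Cardinal.{w}) [Fact κ.IsRegular]
    [H.IsCardinalAccessible κ] : ∃ V : Coalgebra H, isRecursive H V ∧ IsIso V.str := by
  have : Nonempty κ.ord.ToType := by simpa using Cardinal.IsRegular.ne_zero Fact.out
  have : OrderBot κ.ord.ToType := WellFoundedLT.toOrderBot _
  have : NoMaxOrder κ.ord.ToType :=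
    Cardinal.noMaxOrder (Fact.elim inferInstance : κ.IsRegular).aleph0_le
  have := H.preservesColimitsOfShape_of_isCardinalAccessible κ κ.ord.ToType
  have : HasColimitsOfSize.{w, w} (isRecursive H).FullSubcategory := ⟨inferInstance⟩
  let Φ := chainSuccStruct H
  refine ⟨(Φ.iteration κ.ord.ToType).obj, (Φ.iteration κ.ord.ToType).property, ?_⟩
  exact isIso_str_of_isColimit (D := Φ.iterationFunctor κ.ord.ToType ⋙ (isRecursive H).ι)
    (c := (isRecursive H).ι.mapCocone (Φ.iterationCocone κ.ord.ToType))
    (isColimitOfPreserves (forget H) (isColimitOfPreserves (isRecursive H).ι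
      (Φ.isColimitIterationCocone κ.ord.ToType)))
    (fun j ↦ (isRecursive H).ι.mapIso (Φ.iterationFunctorObjSuccIso j (not_isMax j)))
    (fun j ↦ congrArg (·.hom) (Φ.iterationFunctor_map_succ j (not_isMax j)))

end Chain

end CategoryTheory.Endofunctor.Coalgebra

/-! ### Accessibility of binary coproducts -/

namespace CategoryTheory.Limits

variable {C : Type u} [Category.{v} C] [HasBinaryCoproducts C]

instance preservesColimitsOfShape_coprod_functor_obj (X : C) (J : Type u₁) [Category.{v₁} J]
    [IsFiltered J] : PreservesColimitsOfShape J (coprod.functor.obj X) where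
  preservesColimit {K} :=
    { preserves := fun {c} hc ↦ ⟨by
        let ι (j : J) : K.obj j ⟶ c.pt := c.ι.app j
        let f (s : Cocone (K ⋙ coprod.functor.obj X)) (j : J) : X ⨿ K.obj j ⟶ s.pt := s.ι.app j
        have hf (s) {i j : J} (a : i ⟶ j) : coprod.map (𝟙 X) (K.map a) ≫ f s j = f s i := s.w a
        have hinr (s) {i j : J} (a : i ⟶ j) :
            K.map a ≫ coprod.inr ≫ f s j = coprod.inr ≫ f s i := by
          rw [← hf s a, coprod.inr_map_assoc]
        have hinl (s) {i j : J} (a : i ⟶ j) : coprod.inl ≫ f s j = coprod.inl ≫ f s i := by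
          rw [← hf s a, coprod.inl_map_assoc, Category.id_comp]
        -- filteredness makes the component at the fixed object independent of the index
        have hconst (s) (i j : J) : coprod.inl ≫ f s j = coprod.inl ≫ f s i := by
          rw [← hinl s (IsFiltered.leftToMax i j), ← hinl s (IsFiltered.rightToMax i j)]
        let r (s : Cocone (K ⋙ coprod.functor.obj X)) : Cocone K :=
          { pt := s.pt
            ι :=
              { app j := coprod.inr ≫ f s j
                naturality i j a := (hinr s a).trans (Category.comp_id _).symm } }
        let d (s : Cocone (K ⋙ coprod.functor.obj X)) : c.pt ⟶ s.pt := hc.desc (r s)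
        have hd (s) (j : J) : ι j ≫ d s = coprod.inr ≫ f s j := hc.fac (r s) j
        have j₀ : J := IsFiltered.nonempty.some
        have fac (s) (j : J) :
            coprod.map (𝟙 X) (ι j) ≫ coprod.desc (coprod.inl ≫ f s j₀) (d s) = f s j := by
          apply coprod.hom_ext
          · rw [coprod.inl_map_assoc, Category.id_comp, coprod.inl_desc, hconst]
          · rw [coprod.inr_map_assoc, coprod.inr_desc, hd]
        have uniq (s) (m : X ⨿ c.pt ⟶ s.pt) (hm : ∀ j, coprod.map (𝟙 X) (ι j) ≫ m = f s j) :
            m = coprod.desc (coprod.inl ≫ f s j₀) (d s) := by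
          apply coprod.hom_ext
          · rw [coprod.inl_desc, ← hm, coprod.inl_map_assoc, Category.id_comp]
          · rw [coprod.inr_desc]
            refine hc.uniq (r s) _ fun j ↦ ?_
            change ι j ≫ _ = coprod.inr ≫ f s j
            rw [← hm, coprod.inr_map_assoc]
        exact ⟨fun s ↦ coprod.desc (coprod.inl ≫ f s j₀) (d s), fac, uniq⟩⟩ }

instance isCardinalAccessible_coprod_functor_obj (X : C) (κ : Cardinal.{w}) [Fact κ.IsRegular] :
    (coprod.functor.obj X).IsCardinalAccessible κ where
  preservesColimitOfShape J _ _ :=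
    haveI := isFiltered_of_isCardinalFiltered J κ
    inferInstance

end CategoryTheory.Limits

/-! ### Free algebras -/

namespace CategoryTheory.Costrong

variable {A : Type u} [Category.{v} A] {F : A ⥤ A}

section Existence

variable [HasBinaryCoproducts A]

/-- A morphism of algebras for `Y ↦ X + F Y` is a morphism of `F`-algebras that is compatible with
the maps from `X`. -/
lemma coprod_map_desc_eq_iff {X I B : A} {i : X ⨿ F.obj I ⟶ I} {x : X ⟶ B} {b : F.obj B ⟶ B}
    {f : I ⟶ B} : coprod.map (𝟙 X) (F.map f) ≫ coprod.desc x b = i ≫ f ↔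
      coprod.inl ≫ i ≫ f = x ∧ coprod.inr ≫ i ≫ f = F.map f ≫ b := by
  rw [coprod.map_desc, Category.id_comp]
  constructor
  · intro h
    rw [← h, coprod.inl_desc, coprod.inr_desc]
    exact ⟨rfl, rfl⟩
  · rintro ⟨h₁, h₂⟩
    apply coprod.hom_ext
    · rw [coprod.inl_desc, h₁]
    · rw [coprod.inr_desc, h₂]

/-- Morphisms out of an initial algebra of `Y ↦ X + F Y`, considered as an `F`-algebra, correspond
to morphisms out of `X`. -/
noncomputable def homEquivOfIsInitial {X : A} {I : Endofunctor.Algebra (coprodFunctor F X)}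
    (hI : IsInitial I) (B : Endofunctor.Algebra F) :
    ((⟨I.a, coprod.inr ≫ I.str⟩ : Endofunctor.Algebra F) ⟶ B) ≃ (X ⟶ B.a) where
  toFun g := coprod.inl ≫ I.str ≫ g.f
  invFun x :=
    { f := (hI.to ⟨B.a, coprod.desc x B.str⟩).f
      h := ((coprod_map_desc_eq_iff.1 (hI.to ⟨B.a, coprod.desc x B.str⟩).h).2.symm.trans
        (Category.assoc _ _ _).symm) }
  left_inv g := by
    have hg : coprod.map (𝟙 X) (F.map g.f) ≫ coprod.desc (coprod.inl ≫ I.str ≫ g.f) B.str =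
        I.str ≫ g.f :=
      coprod_map_desc_eq_iff.2 ⟨rfl, ((Category.assoc _ _ _).symm.trans g.h.symm)⟩
    have h := hI.hom_ext
      (hI.to ⟨B.a, coprod.desc (coprod.inl ≫ I.str ≫ g.f) B.str⟩) ⟨g.f, hg⟩
    exact Endofunctor.Algebra.ext (congrArg (fun k ↦ k.f) h)
  right_inv x := (coprod_map_desc_eq_iff.1 (hI.to ⟨B.a, coprod.desc x B.str⟩).h).1

/-- An accessible endofunctor of a cocomplete category has a free monad. -/
theorem nonempty_freeMonad (F : A ⥤ A) (κ : Cardinal.{w}) [Fact κ.IsRegular]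
    [F.IsCardinalAccessible κ] [HasColimitsOfSize.{w, w} A] : Nonempty (FreeMonad F) := by
  have h (X : A) : ∃ I : Endofunctor.Algebra (coprodFunctor F X), Nonempty (IsInitial I) := by
    obtain ⟨V, hV, _⟩ :=
      Endofunctor.Coalgebra.exists_isRecursive_isIso_str (H := coprodFunctor F X) κ
    exact ⟨_, ⟨Endofunctor.Coalgebra.isInitialOfIsRecursiveMap V.str hV⟩⟩
  choose I hI using h
  refine ⟨⟨_, Adjunction.adjunctionOfEquivLeft
    (fun X B ↦ homEquivOfIsInitial (hI X).some B) fun X B B' g f ↦ ?_⟩⟩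
  exact (coprod.inl ≫= (Category.assoc (I X).str f.f g.f).symm).trans
    (Category.assoc _ _ _).symm

end Existence

namespace FreeMonad

variable (T : FreeMonad F)

/-- The unit `X ⟶ T X` of a free monad. -/
def unit (X : A) : X ⟶ T.toMonad.obj X :=
  T.toMonad.η.app X

/-- The morphism of `F`-algebras `T X ⟶ B` that extends `x : X ⟶ B`. -/
def lift {X B : A} (b : F.obj B ⟶ B) (x : X ⟶ B) : T.toMonad.obj X ⟶ B :=
  ((T.adj.homEquiv X ⟨B, b⟩).symm x).f

lemma unit_lift {X B : A} (b : F.obj B ⟶ B) (x : X ⟶ B) : T.unit X ≫ T.lift b x = x :=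
  (T.adj.homEquiv_unit X ⟨B, b⟩ _).symm.trans ((T.adj.homEquiv X ⟨B, b⟩).apply_symm_apply x)

lemma str_lift {X B : A} (b : F.obj B ⟶ B) (x : X ⟶ B) :
    T.str X ≫ T.lift b x = F.map (T.lift b x) ≫ b :=
  ((T.adj.homEquiv X ⟨B, b⟩).symm x).h.symm

variable {T} in
/-- Freeness: two morphisms of `F`-algebras out of `T X` that agree on `X` are equal. -/
lemma hom_ext {X B : A} (b : F.obj B ⟶ B) {f g : T.toMonad.obj X ⟶ B}
    (hunit : T.unit X ≫ f = T.unit X ≫ g)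
    (hf : T.str X ≫ f = F.map f ≫ b) (hg : T.str X ≫ g = F.map g ≫ b) : f = g := by
  let f' : T.free.obj X ⟶ ⟨B, b⟩ := ⟨f, hf.symm⟩
  let g' : T.free.obj X ⟶ ⟨B, b⟩ := ⟨g, hg.symm⟩
  have h : f' = g' := (T.adj.homEquiv X ⟨B, b⟩).injective
    ((T.adj.homEquiv_unit X ⟨B, b⟩ f').trans
      (hunit.trans (T.adj.homEquiv_unit X ⟨B, b⟩ g').symm))
  exact congrArg Endofunctor.Algebra.Hom.f h

lemma unit_map {X Y : A} (x : X ⟶ Y) :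
    T.unit X ≫ T.toMonad.map x = x ≫ T.unit Y :=
  (T.toMonad.η.naturality x).symm

lemma str_map {X Y : A} (x : X ⟶ Y) :
    T.str X ≫ T.toMonad.map x = F.map (T.toMonad.map x) ≫ T.str Y :=
  (T.free.map x).h.symm

lemma unit_μ (X : A) :
    T.unit (T.toMonad.obj X) ≫ T.toMonad.μ.app X = 𝟙 (T.toMonad.obj X) :=
  T.toMonad.left_unit X

lemma str_μ (X : A) :
    T.str (T.toMonad.obj X) ≫ T.toMonad.μ.app X = F.map (T.toMonad.μ.app X) ≫ T.str X :=
  (T.adj.counit.app (T.free.obj X)).h.symm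

lemma inMap_eq [HasBinaryCoproducts A] (X : A) : T.inMap X = coprod.desc (T.unit X) (T.str X) :=
  rfl

/-- A morphism of algebras for `Y ↦ X + F Y` out of `T X` is a morphism of `F`-algebras with
prescribed restriction to `X`. -/
lemma inMap_comp_iff [HasBinaryCoproducts A] {X B : A} (b : X ⨿ F.obj B ⟶ B)
    {f : T.toMonad.obj X ⟶ B} :
    coprod.map (𝟙 X) (F.map f) ≫ b = T.inMap X ≫ f ↔
      T.unit X ≫ f = coprod.inl ≫ b ∧ T.str X ≫ f = F.map f ≫ coprod.inr ≫ b := by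
  constructor
  · intro h
    have h₁ := coprod.inl ≫= h
    have h₂ := coprod.inr ≫= h
    rw [coprod.inl_map_assoc, inMap_eq, coprod.inl_desc_assoc, Category.id_comp] at h₁
    rw [coprod.inr_map_assoc, inMap_eq, coprod.inr_desc_assoc] at h₂
    exact ⟨h₁.symm, h₂.symm⟩
  · rintro ⟨h₁, h₂⟩
    apply coprod.hom_ext
    · rw [coprod.inl_map_assoc, inMap_eq, coprod.inl_desc_assoc, Category.id_comp]
      exact h₁.symm
    · rw [coprod.inr_map_assoc, inMap_eq, coprod.inr_desc_assoc, h₂]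

/-- The free algebra on `X` is an initial algebra of `Y ↦ X + F Y`. -/
noncomputable def isInitialInAlgebra [HasBinaryCoproducts A] (X : A) :
    IsInitial (T.inAlgebra X) :=
  IsInitial.ofUniqueHom
    (fun B ↦
      { f := T.lift (coprod.inr ≫ B.str) (coprod.inl ≫ B.str)
        h := (T.inMap_comp_iff B.str).2 ⟨T.unit_lift _ _, T.str_lift _ _⟩ })
    (fun B m ↦ by
      obtain ⟨h₁, h₂⟩ := (T.inMap_comp_iff B.str).1 m.h
      exact Endofunctor.Algebra.ext
        (hom_ext _ (h₁.trans (T.unit_lift _ _).symm) h₂ (T.str_lift _ _)))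

/-! ### The costrength of a free monad -/

variable {M : Type u₁} [Category.{v₁} M] [MonoidalCategory M] [MonoidalLeftAction M A]
  (s : F.OplaxLeftLinear M)

/-- The costrength of `T` at `m` and `X`: the morphism of `F`-algebras extending `m · η`, where
`m · T X` carries the structure `F (m · T X) ⟶ m · F (T X) ⟶ m · T X`. -/
def costrengthApp (m : M) (X : A) : T.toMonad.obj (m ⊙ₗ X) ⟶ m ⊙ₗ T.toMonad.obj X :=
  T.lift (cst s m (T.toMonad.obj X) ≫ m ⊴ₗ T.str X) (m ⊴ₗ T.unit X)

lemma unit_costrengthApp (m : M) (X : A) :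
    T.unit (m ⊙ₗ X) ≫ T.costrengthApp s m X = m ⊴ₗ T.unit X :=
  T.unit_lift _ _

lemma str_costrengthApp (m : M) (X : A) :
    T.str (m ⊙ₗ X) ≫ T.costrengthApp s m X =
      F.map (T.costrengthApp s m X) ≫ cst s m (T.toMonad.obj X) ≫ m ⊴ₗ T.str X :=
  T.str_lift _ _

/-- The square that determines the costrength says that `f` is the morphism of `F`-algebras
extending `m · η`. -/
lemma costrengthSquare_iff [HasBinaryCoproducts A] {m : M} {X : A}
    {f : T.toMonad.obj (m ⊙ₗ X) ⟶ m ⊙ₗ T.toMonad.obj X} :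
    T.CostrengthSquare s m X f ↔
      T.unit (m ⊙ₗ X) ≫ f = m ⊴ₗ T.unit X ∧
        T.str (m ⊙ₗ X) ≫ f = F.map f ≫ cst s m (T.toMonad.obj X) ≫ m ⊴ₗ T.str X := by
  rw [CostrengthSquare, inMap_eq, inMap_eq]
  simp only [coprod.desc_comp, coprod.map_desc, Category.id_comp, ← actionHomRight_comp,
    coprod.inl_desc, coprod.inr_desc]
  constructor
  · intro h
    have h₁ := coprod.inl ≫= h
    have h₂ := coprod.inr ≫= h
    simp only [coprod.inl_desc, coprod.inr_desc] at h₁ h₂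
    exact ⟨h₁, h₂⟩
  · rintro ⟨h₁, h₂⟩
    rw [h₁, h₂]

/-- The costrength of a free monad on `F` that is induced by a costrength of `F`. Each axiom is an
equation between morphisms of `F`-algebras out of a free algebra, so it is checked on generators;
the algebra structure on the common target is written out in every case. -/
@[reducible]
def costrength : T.toMonad.toFunctor.OplaxLeftLinear M where
  δₗ := T.costrengthApp s
  δₗ_naturality_left {c c'} f X := by
    refine hom_ext (cst s c' (T.toMonad.obj X) ≫ c' ⊴ₗ T.str X) ?_ ?_ ?_
    · rw [reassoc_of% T.unit_map, unit_costrengthApp, reassoc_of% T.unit_costrengthApp,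
        action_exchange]
    · rw [reassoc_of% T.str_map, str_costrengthApp, F.map_comp, Category.assoc]
    · have h := s.δₗ_naturality_left f (T.toMonad.obj X)
      rw [reassoc_of% T.str_costrengthApp, action_exchange, F.map_comp, Category.assoc,
        reassoc_of% h]
  δₗ_naturality_right c X Y f := by
    refine hom_ext (cst s c (T.toMonad.obj Y) ≫ c ⊴ₗ T.str Y) ?_ ?_ ?_
    · rw [reassoc_of% T.unit_map, unit_costrengthApp, reassoc_of% T.unit_costrengthApp,
        ← actionHomRight_comp,
        ← actionHomRight_comp, unit_map]
    · rw [reassoc_of% T.str_map, str_costrengthApp, F.map_comp, Category.assoc]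
    · have h := s.δₗ_naturality_right c (T.toMonad.map f)
      rw [reassoc_of% T.str_costrengthApp, ← actionHomRight_comp, str_map, actionHomRight_comp,
        F.map_comp, Category.assoc, reassoc_of% h]
  δₗ_associativity c c' X := by
    refine hom_ext (cst s c (c' ⊙ₗ T.toMonad.obj X) ≫
      c ⊴ₗ (cst s c' (T.toMonad.obj X) ≫ c' ⊴ₗ T.str X)) ?_ ?_ ?_
    · rw [reassoc_of% T.unit_costrengthApp, reassoc_of% T.unit_map,
        reassoc_of% T.unit_costrengthApp, ← actionHomRight_comp,
        unit_costrengthApp, tensor_actionHomRight, Category.assoc, Category.assoc, Iso.inv_hom_id,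
        Category.comp_id]
    · have h := s.δₗ_associativity c c' (T.toMonad.obj X)
      rw [reassoc_of% T.str_costrengthApp, tensor_actionHomRight, Category.assoc, Category.assoc,
        Iso.inv_hom_id, Category.comp_id, reassoc_of% h, F.map_comp, Category.assoc,
        actionHomRight_comp]
    · have h := s.δₗ_naturality_right c (T.costrengthApp s c' X)
      rw [reassoc_of% T.str_map, reassoc_of% T.str_costrengthApp, ← actionHomRight_comp,
        str_costrengthApp,
        actionHomRight_comp, F.map_comp, F.map_comp, Category.assoc, Category.assoc,
        reassoc_of% h]
  δₗ_unitality_inv X := by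
    refine hom_ext (cst s (𝟙_ M) (T.toMonad.obj X) ≫ 𝟙_ M ⊴ₗ T.str X) ?_ ?_ ?_
    · rw [reassoc_of% T.unit_map, unit_costrengthApp, actionUnitIso_inv_naturality]
    · have h := s.δₗ_unitality_inv (T.toMonad.obj X)
      rw [← actionUnitIso_inv_naturality, h, Category.assoc]
    · rw [reassoc_of% T.str_map, str_costrengthApp, F.map_comp, Category.assoc]

lemma isCostrongMonad_costrength : IsCostrongMonad T.toMonad (T.costrength s) where
  unit m X := (T.unit_costrengthApp s m X).trans (Category.id_comp _).symm
  mul m X := by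
    change T.toMonad.μ.app (m ⊙ₗ X) ≫ T.costrengthApp s m X =
      (T.toMonad.map (T.costrengthApp s m X) ≫ T.costrengthApp s m (T.toMonad.obj X)) ≫
        m ⊴ₗ T.toMonad.μ.app X
    refine hom_ext (X := T.toMonad.obj (m ⊙ₗ X))
      (cst s m (T.toMonad.obj X) ≫ m ⊴ₗ T.str X) ?_ ?_ ?_
    · rw [reassoc_of% T.unit_μ, Category.assoc, reassoc_of% T.unit_map,
        reassoc_of% T.unit_costrengthApp, ← actionHomRight_comp,
        unit_μ, actionHomRight_id, Category.comp_id]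
    · rw [reassoc_of% T.str_μ, str_costrengthApp, F.map_comp, Category.assoc]
    · have h := s.δₗ_naturality_right m (T.toMonad.μ.app X)
      rw [Category.assoc, reassoc_of% T.str_map, reassoc_of% T.str_costrengthApp,
        ← actionHomRight_comp, str_μ,
        actionHomRight_comp, F.map_comp, F.map_comp, Category.assoc, Category.assoc,
        reassoc_of% h]

end FreeMonad

end CategoryTheory.Costrong

theorem mainTheorem4 {M : Type u₁} [Category.{v₁} M] [MonoidalCategory M]
    {A : Type u} [Category.{v} A] [MonoidalLeftAction M A] [IsLocallyPresentable.{w} A]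
    (F : A ⥤ A) [Functor.IsAccessible.{w} F] (s : F.OplaxLeftLinear M) :
    haveI : HasBinaryCoproducts A :=
      Costrong.hasBinaryCoproducts_of_isLocallyPresentable.{w} A
    Nonempty (Costrong.FreeMonad F) ∧
    ∀ T : Costrong.FreeMonad F,
      (∀ X : A, Nonempty (IsInitial (T.inAlgebra X))) ∧
      ∃ t : T.toMonad.toFunctor.OplaxLeftLinear M,
        Costrong.IsCostrongMonad T.toMonad t ∧
        ∀ (m : M) (X : A), T.CostrengthSquare s m X (Costrong.cst t m X) ∧
          ∀ f : T.toMonad.obj (m ⊙ₗ X) ⟶ m ⊙ₗ T.toMonad.obj X,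
            T.CostrengthSquare s m X f → f = Costrong.cst t m X := by
  have : HasBinaryCoproducts A := Costrong.hasBinaryCoproducts_of_isLocallyPresentable.{w} A
  refine ⟨?_, fun T ↦ ⟨fun X ↦ ⟨T.isInitialInAlgebra X⟩, T.costrength s,
    T.isCostrongMonad_costrength s, fun m X ↦ ⟨?_, fun f hf ↦ ?_⟩⟩⟩
  · obtain ⟨κ', _, _⟩ := IsLocallyPresentable.exists_cardinal.{w} A
    obtain ⟨κ, _, _⟩ := Functor.IsAccessible.exists_cardinal.{w} (F := F)
    exact Costrong.nonempty_freeMonad F κ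
  · exact (T.costrengthSquare_iff s).2 ⟨T.unit_costrengthApp s m X, T.str_costrengthApp s m X⟩
  · obtain ⟨h₁, h₂⟩ := (T.costrengthSquare_iff s).1 hf
    exact Costrong.FreeMonad.hom_ext _ (h₁.trans (T.unit_costrengthApp s m X).symm) h₂
      (T.str_costrengthApp s m X)
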